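/- Let $\alpha_1,\alpha_2\in\mathbb{R}$ with $\alpha_1+\alpha_2\neq 0$, and put $c_1=2\alpha_2-(\alpha_1+\alpha_2)^2$ and $c_2=\alpha_2-(\alpha_1+\alpha_2)^2$. For $m\ge 1$ let $P=P(m)\in\mathbb{R}^{m\times m}$ be the matrix whose last row and last column are zero and whose leading $(m-1)\times(m-1)$ block has all diagonal entries equal to $c_1$, all entries above the diagonal equal to $c_2$ and all entries below the diagonal equal to $\alpha_2$. Write $\mathbb{1}$ for a column vector of ones. Interlacing property. Let $\varepsilon(m)=(m-1)^{-1}(1-m^{-1/2})$, let $A(m)\in\mathbb{R}^{m\times m}$ be the skew-symmetric matrix with all entries above the diagonal equal to $1$, let $B(m)=\mathbb{1}b-(\mathbb{1}b)^\top$ with the row vector $b=[0\ 2\ 4\ \cdots\ 2(m-1)]$, and let $C(m)=A(m)-\varepsilon(m+1)B(m)$. Let $\pm\omega_k^m i$ be the eigenvalues of the skew-symmetric matrix $C(m)$, with $\omega^m_1\ge\omega^m_2\ge\cdots\ge\omega^m_{\lceil m/2\rceil}\ge 0$. The interlacing property is the assertion that for every $m\ge 2$ and every $k=1,\ldots,\lfloor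 m/2\rfloor$ $$\omega_k^{m+1}>\omega_k^m>\omega_{k+1}^{m+1}\ge 0 .$$ Theorem. Let $T_d\in\mathbb{R}^{2n\times 2n}$. Suppose that either (i) $T_d$ is normal, $(2\alpha_2-(\alpha_1+\alpha_2)^2)(T_d+T_d^\top)$ is positive definite, and the interlacing property holds; or (ii) $T_d$ is skew-symmetric and $2\alpha_2-(\alpha_1+\alpha_2)^2=0$. Then there exist an integer $m\ge \operatorname{rk}(T_d)+1$ and a matrix $W\in\mathbb{R}^{2n\times m}$ such that $$W\,P(m)\,W^\top=T_d\qquad\text{and}\qquad W\mathbb{1}=0 .$$ -/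

import Mathlib

/-- The coefficient `c₁ = 2 α₂ - (α₁ + α₂)²`. -/
def mapCoeff₁ (α₁ α₂ : ℝ) : ℝ := 2 * α₂ - (α₁ + α₂) ^ 2

/-- The coefficient `c₂ = α₂ - (α₁ + α₂)²`. -/
def mapCoeff₂ (α₁ α₂ : ℝ) : ℝ := α₂ - (α₁ + α₂) ^ 2

/-- The `m × m` matrix `P`: its last row and last column vanish, and its leading
`(m-1) × (m-1)` block has `c₁` on the diagonal, `c₂` above it and `α₂` below it. -/
def mapMatrix (α₁ α₂ : ℝ) (m : ℕ) : Matrix (Fin m) (Fin m) ℝ :=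
  Matrix.of fun i j =>
    if (i : ℕ) + 1 = m ∨ (j : ℕ) + 1 = m then 0
    else if i = j then mapCoeff₁ α₁ α₂
    else if i < j then mapCoeff₂ α₁ α₂
    else α₂

/-- `ε(m) = (m - 1)⁻¹ (1 - m^(-1/2))`. -/
noncomputable def interlaceEps (m : ℕ) : ℝ :=
  ((m : ℝ) - 1)⁻¹ * (1 - (Real.sqrt (m : ℝ))⁻¹)

/-- The skew-symmetric `m × m` matrix `A(m)`: `1` above the diagonal, `-1` below it. -/
def interlaceA (m : ℕ) : Matrix (Fin m) (Fin m) ℝ :=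
  Matrix.of fun i j => if i < j then 1 else if j < i then -1 else 0

/-- The skew-symmetric `m × m` matrix `B(m) = 𝟙 b - (𝟙 b)ᵀ` with the row
`b = [0 2 4 … 2(m-1)]`. -/
def interlaceB (m : ℕ) : Matrix (Fin m) (Fin m) ℝ :=
  Matrix.vecMulVec (fun _ : Fin m => 1) (fun j : Fin m => 2 * (j : ℝ)) -
    (Matrix.vecMulVec (fun _ : Fin m => 1) (fun j : Fin m => 2 * (j : ℝ))).transpose

/-- `C(m) = A(m) - ε(m+1) B(m)`. -/
noncomputable def interlaceC (m : ℕ) : Matrix (Fin m) (Fin m) ℝ :=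
  interlaceA m - interlaceEps (m + 1) • interlaceB m

/-- The number `ω_k` of a real skew-symmetric `p × p` matrix `C`, for `1 ≤ k ≤ ⌈p/2⌉`.
The complex eigenvalues of `C` (with multiplicity) are `± ω_k i` with
`ω_1 ≥ ω_2 ≥ ⋯ ≥ ω_⌈p/2⌉ ≥ 0` (the last one being a single `0` if `p` is odd), so that `ω_k` is
the `k`-th entry of the list of their imaginary parts sorted from the largest to the smallest. -/
noncomputable def skewFreq {p : ℕ} (C : Matrix (Fin p) (Fin p) ℝ) (k : ℕ) : ℝ :=
  (((C.map Complex.ofReal).charpoly.roots.map Complex.im).sort (· ≥ ·)).getD (k - 1) 0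

/-- The interlacing property: for every `m ≥ 2` and `k = 1, …, ⌊m/2⌋`,
`ω_k(m+1) > ω_k(m) > ω_{k+1}(m+1) ≥ 0`, where `± ω_k(m) i` are the eigenvalues of `C(m)`. -/
def InterlacingProperty : Prop :=
  ∀ m : ℕ, 2 ≤ m → ∀ k : ℕ, 1 ≤ k → k ≤ m / 2 →
    skewFreq (interlaceC (m + 1)) k > skewFreq (interlaceC m) k ∧
    skewFreq (interlaceC m) k > skewFreq (interlaceC (m + 1)) (k + 1) ∧
    skewFreq (interlaceC (m + 1)) (k + 1) ≥ 0

/-! Read the columns `w_i` of `W` as successive edges of a path. As `c₂ + α₂ = c₁` and `c₂ - α₂ =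
-(α₁ + α₂)²`, a closed path yields the symmetric part `(c₁/2) ∑ w_i w_iᵀ` plus a skew part, `-(α₁ +
α₂)²` times the enclosed signed area. Cutting each edge into `k` pieces keeps the area but divides
the symmetric part by `k`. So subdivided rectangles give any skew matrix with small symmetric error,
and back-and-forth edges, which enclose no area, fill up the rest of `c₁ • 1`. A congruence then
turns `1` into any positive definite matrix. -/

/-- The leading block of `mapMatrix`. -/
def mapBlock (α₁ α₂ : ℝ) (p : ℕ) : Matrix (Fin p) (Fin p) ℝ :=
  Matrix.of fun i j =>
    if i = j then mapCoeff₁ α₁ α₂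
    else if i < j then mapCoeff₂ α₁ α₂
    else α₂

/-- `T = W * mapBlock * Wᵀ` for some `W` whose columns add up to `σ`. -/
def Realizes {d : ℕ} (α₁ α₂ : ℝ) (T : Matrix (Fin d) (Fin d) ℝ) (σ : Fin d → ℝ) : Prop :=
  ∃ p : ℕ, ∃ W : Matrix (Fin d) (Fin p) ℝ,
    W * mapBlock α₁ α₂ p * W.transpose = T ∧ W.mulVec (fun _ => 1) = σ

theorem mapCoeff_add (α₁ α₂ : ℝ) : mapCoeff₂ α₁ α₂ + α₂ = mapCoeff₁ α₁ α₂ := by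
  unfold mapCoeff₁ mapCoeff₂; ring

theorem mul_mul_transpose_apply {d p : ℕ} (W : Matrix (Fin d) (Fin p) ℝ)
    (M : Matrix (Fin p) (Fin p) ℝ) (a b : Fin d) :
    (W * M * W.transpose) a b = ∑ i, ∑ j, W a i * M i j * W b j := by
  simp only [Matrix.mul_apply, Matrix.transpose_apply, Finset.sum_mul]
  exact Finset.sum_comm

theorem realizes_zero {d : ℕ} (α₁ α₂ : ℝ) :
    Realizes α₁ α₂ (0 : Matrix (Fin d) (Fin d) ℝ) 0 := by
  refine ⟨0, 0, by simp, by simp⟩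

theorem realizes_single {d : ℕ} (α₁ α₂ : ℝ) (u : Fin d → ℝ) :
    Realizes α₁ α₂ (mapCoeff₁ α₁ α₂ • Matrix.vecMulVec u u) u := by
  refine ⟨1, Matrix.of fun a _ => u a, ?_, ?_⟩
  · ext a b
    rw [mul_mul_transpose_apply]
    simp [mapBlock, Matrix.vecMulVec_apply]
    ring
  · ext a
    simp [Matrix.mulVec, dotProduct]

/-- Concatenation of paths: the edges of the first precede those of the second, so the cross terms
see only the two sums. Closed paths therefore simply add. -/
theorem Realizes.append {d : ℕ} {α₁ α₂ : ℝ} {S T : Matrix (Fin d) (Fin d) ℝ}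
    {σ τ : Fin d → ℝ} (hS : Realizes α₁ α₂ S σ) (hT : Realizes α₁ α₂ T τ) :
    Realizes α₁ α₂ (S + T + mapCoeff₂ α₁ α₂ • Matrix.vecMulVec σ τ +
      α₂ • Matrix.vecMulVec τ σ) (σ + τ) := by
  obtain ⟨p, V, rfl, rfl⟩ := hS
  obtain ⟨q, W, rfl, rfl⟩ := hT
  refine ⟨p + q, Matrix.of fun a => Fin.append (V a) (W a), ?_, ?_⟩
  · ext a b
    have h₁ : ∀ (i : Fin p) (j : Fin q), Fin.castAdd q i ≠ Fin.natAdd p j := by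
      intro i j h
      have := congrArg Fin.val h
      simp only [Fin.val_castAdd, Fin.val_natAdd] at this
      omega
    simp only [Matrix.add_apply, mul_mul_transpose_apply, Matrix.smul_apply,
      Matrix.vecMulVec_apply, Fin.sum_univ_add, Matrix.of_apply, Fin.append_left,
      Fin.append_right, mapBlock, h₁, (h₁ _ _).symm, if_false,
      Fin.castAdd_inj, Fin.natAdd_inj, Matrix.mulVec, dotProduct, mul_one, smul_eq_mul,
      Finset.sum_add_distrib, Fin.lt_def, Fin.val_castAdd, Fin.val_natAdd,
      Nat.add_lt_add_iff_left]
    have h₂ : ∑ i, ∑ j, V a i * mapCoeff₂ α₁ α₂ * W b j =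
        mapCoeff₂ α₁ α₂ * ((∑ i, V a i) * ∑ j, W b j) := by
      rw [Finset.sum_mul_sum, Finset.mul_sum]
      refine Finset.sum_congr rfl fun i _ => ?_
      rw [Finset.mul_sum]
      exact Finset.sum_congr rfl fun j _ => by ring
    have h₃ : ∑ i, ∑ j, W a i * α₂ * V b j = α₂ * ((∑ i, W a i) * ∑ j, V b j) := by
      rw [Finset.sum_mul_sum, Finset.mul_sum]
      refine Finset.sum_congr rfl fun i _ => ?_
      rw [Finset.mul_sum]
      exact Finset.sum_congr rfl fun j _ => by ring
    have h₄ : ∀ (i : Fin p) (j : Fin q), ((i : ℕ) < p + j) = True := fun i j => by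
      simp only [eq_iff_iff, iff_true]; omega
    have h₅ : ∀ (i : Fin p) (j : Fin q), (p + (j : ℕ) < i) = False := fun i j => by
      simp only [eq_iff_iff, iff_false]; omega
    simp only [h₄, h₅, if_true, if_false]
    rw [h₂, h₃]
    ring
  · ext a
    simp [Matrix.mulVec, dotProduct, Fin.sum_univ_add]

theorem Realizes.add {d : ℕ} {α₁ α₂ : ℝ} {S T : Matrix (Fin d) (Fin d) ℝ}
    (hS : Realizes α₁ α₂ S 0) (hT : Realizes α₁ α₂ T 0) : Realizes α₁ α₂ (S + T) 0 := by
  simpa using hS.append hT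

theorem Realizes.sum {d : ℕ} {α₁ α₂ : ℝ} {ι : Type*} (s : Finset ι)
    {T : ι → Matrix (Fin d) (Fin d) ℝ} (hT : ∀ i ∈ s, Realizes α₁ α₂ (T i) 0) :
    Realizes α₁ α₂ (∑ i ∈ s, T i) 0 :=
  Finset.sum_induction T (fun M => Realizes α₁ α₂ M 0) (fun _ _ => Realizes.add)
    (realizes_zero α₁ α₂) hT

theorem Realizes.congr_mul {d : ℕ} {α₁ α₂ : ℝ} {T : Matrix (Fin d) (Fin d) ℝ}
    (hT : Realizes α₁ α₂ T 0) (Q : Matrix (Fin d) (Fin d) ℝ) :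
    Realizes α₁ α₂ (Q * T * Q.transpose) 0 := by
  obtain ⟨p, W, rfl, hW⟩ := hT
  refine ⟨p, Q * W, ?_, ?_⟩
  · simp only [Matrix.transpose_mul, Matrix.mul_assoc]
  · rw [← Matrix.mulVec_mulVec, hW, Matrix.mulVec_zero]

theorem realizes_repeat {d : ℕ} (α₁ α₂ : ℝ) (u : Fin d → ℝ) (k : ℕ) :
    Realizes α₁ α₂ ((mapCoeff₁ α₁ α₂ * (k * (k + 1) / 2)) • Matrix.vecMulVec u u)
      ((k : ℝ) • u) := by
  induction k with
  | zero => simpa using realizes_zero α₁ α₂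
  | succ k ih =>
    convert ih.append (realizes_single α₁ α₂ u) using 1
    · ext a b
      simp only [Matrix.add_apply, Matrix.smul_apply, Matrix.vecMulVec_apply, Pi.smul_apply,
        smul_eq_mul, ← mapCoeff_add]
      push_cast
      ring
    · ext a
      simp only [Pi.add_apply, Pi.smul_apply, smul_eq_mul]
      push_cast
      ring

theorem realizes_subdivided {d : ℕ} (α₁ α₂ : ℝ) (u : Fin d → ℝ) {k : ℕ} (hk : k ≠ 0) :
    Realizes α₁ α₂ ((mapCoeff₁ α₁ α₂ * ((1 + (k : ℝ)⁻¹) / 2)) • Matrix.vecMulVec u u) u := by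
  have hk' : (k : ℝ) ≠ 0 := Nat.cast_ne_zero.2 hk
  convert realizes_repeat α₁ α₂ ((k : ℝ)⁻¹ • u) k using 1
  · ext a b
    simp only [Matrix.smul_apply, Matrix.vecMulVec_apply, Pi.smul_apply, smul_eq_mul]
    field_simp
  · rw [smul_smul, mul_inv_cancel₀ hk', one_smul]

/-- Closed rectangles with edges `u`, `v`, each cut into `k` equal parts. -/
theorem realizes_rectangle {d : ℕ} (α₁ α₂ : ℝ) (u v : Fin d → ℝ) {k : ℕ} (hk : k ≠ 0) :
    Realizes α₁ α₂ ((mapCoeff₁ α₁ α₂ * (k : ℝ)⁻¹) •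
        (Matrix.vecMulVec u u + Matrix.vecMulVec v v) -
      (α₁ + α₂) ^ 2 • (Matrix.vecMulVec u v - Matrix.vecMulVec v u)) 0 := by
  convert (((realizes_subdivided α₁ α₂ u hk).append (realizes_subdivided α₁ α₂ v hk)).append
    (realizes_subdivided α₁ α₂ (-u) hk)).append (realizes_subdivided α₁ α₂ (-v) hk) using 1
  · ext a b
    simp only [Matrix.add_apply, Matrix.sub_apply, Matrix.smul_apply, Matrix.vecMulVec_apply,
      Pi.add_apply, Pi.neg_apply, smul_eq_mul, mapCoeff₁, mapCoeff₂]
    ring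
  · ext a
    simp

theorem realizes_square {d : ℕ} (α₁ α₂ : ℝ) (u : Fin d → ℝ) :
    Realizes α₁ α₂ (mapCoeff₁ α₁ α₂ • Matrix.vecMulVec u u) 0 := by
  convert (realizes_single α₁ α₂ u).append (realizes_single α₁ α₂ (-u)) using 1
  · ext a b
    simp only [Matrix.add_apply, Matrix.smul_apply, Matrix.vecMulVec_apply, Pi.neg_apply,
      smul_eq_mul, ← mapCoeff_add]
    ring
  · simp

theorem realizes_diagonal {d : ℕ} (α₁ α₂ : ℝ) {D : Fin d → ℝ} (hD : ∀ a, 0 ≤ D a) :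
    Realizes α₁ α₂ (mapCoeff₁ α₁ α₂ • Matrix.diagonal D) 0 := by
  have h := Realizes.sum Finset.univ fun c _ =>
    realizes_square α₁ α₂ (Pi.single c (Real.sqrt (D c)))
  convert h using 1
  ext a b
  simp only [Matrix.smul_apply, Matrix.sum_apply, Matrix.vecMulVec_apply, smul_eq_mul,
    ← Finset.mul_sum, Pi.single_apply, ite_mul, zero_mul, Finset.sum_ite_eq, Finset.mem_univ,
    if_true, Matrix.diagonal_apply]
  by_cases hab : a = b
  · subst hab; simp [Real.mul_self_sqrt (hD a)]
  · simp [hab, Ne.symm hab]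

/-- A skew-symmetric matrix, up to an arbitrarily small diagonal symmetric part. -/
theorem exists_realizes_diagonal_add_skew {d : ℕ} {α₁ α₂ : ℝ} (hα : α₁ + α₂ ≠ 0)
    {K : Matrix (Fin d) (Fin d) ℝ} (hK : K.transpose = -K) :
    ∃ D : Fin d → ℝ, ∀ k : ℕ, k ≠ 0 →
      Realizes α₁ α₂ ((mapCoeff₁ α₁ α₂ * (k : ℝ)⁻¹) • Matrix.diagonal D + K) 0 := by
  -- One rectangle with edges `e_x`, `t x y • e_y` per ordered pair; each plane occurs twice, hence
  -- the 2.
  set t : Fin d → Fin d → ℝ := fun a b => -K a b / (2 * (α₁ + α₂) ^ 2) with ht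
  refine ⟨fun a => ∑ c, (1 + t c a ^ 2), fun k hk => ?_⟩
  have h := Realizes.sum Finset.univ fun x _ => Realizes.sum Finset.univ fun y _ =>
    realizes_rectangle α₁ α₂ (Pi.single x 1 : Fin d → ℝ) (Pi.single y (t x y)) hk
  convert h using 1
  ext a b
  have hK' : K b a = -K a b := congrFun (congrFun hK a) b
  have ht' : (α₁ + α₂) ^ 2 * (t a b - t b a) = -K a b := by
    simp only [ht, hK']
    field_simp
    ring
  simp only [Matrix.add_apply, Matrix.sub_apply, Matrix.smul_apply, Matrix.sum_apply,
    Matrix.vecMulVec_apply, smul_eq_mul, Matrix.diagonal_apply, ← Finset.mul_sum,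
    Finset.sum_sub_distrib, Finset.sum_add_distrib, Pi.single_apply]
  by_cases hab : a = b
  · subst hab
    have h0 : K a a = 0 := by linarith
    simp [h0, pow_two]
  · simp [hab]
    linarith

theorem realizes_smul_one_add_skew {d : ℕ} {α₁ α₂ : ℝ} (hα : α₁ + α₂ ≠ 0)
    {K : Matrix (Fin d) (Fin d) ℝ} (hK : K.transpose = -K) :
    Realizes α₁ α₂ (mapCoeff₁ α₁ α₂ • (1 : Matrix (Fin d) (Fin d) ℝ) + K) 0 := by
  obtain ⟨D, hD⟩ := exists_realizes_diagonal_add_skew hα hK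
  -- With `k` this large, `1 - D/k` is nonnegative, so degenerate paths can supply it.
  obtain ⟨k, hk⟩ := exists_nat_gt (∑ a, |D a|)
  have hpos : (0 : ℝ) < k := lt_of_le_of_lt (Finset.sum_nonneg fun _ _ => abs_nonneg _) hk
  have hk0 : k ≠ 0 := by rintro rfl; simp at hpos
  have hle : ∀ a, 0 ≤ 1 - (k : ℝ)⁻¹ * D a := by
    intro a
    have h₁ : D a ≤ k := (le_abs_self _).trans
      ((Finset.single_le_sum (f := fun a => |D a|) (fun _ _ => abs_nonneg _)
        (Finset.mem_univ a)).trans hk.le)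
    have h₂ : (k : ℝ)⁻¹ * D a ≤ (k : ℝ)⁻¹ * k := by gcongr
    rw [inv_mul_cancel₀ hpos.ne'] at h₂
    linarith
  convert (realizes_diagonal α₁ α₂ hle).add (hD k hk0) using 1
  ext a b
  simp only [Matrix.add_apply, Matrix.smul_apply, Matrix.diagonal_apply, Matrix.one_apply,
    smul_eq_mul]
  split_ifs <;> ring

theorem realizes_smul_mul_transpose_add_skew {d : ℕ} {α₁ α₂ : ℝ} (hα : α₁ + α₂ ≠ 0)
    {K Q : Matrix (Fin d) (Fin d) ℝ} (hK : K.transpose = -K) (hQ : IsUnit Q) :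
    Realizes α₁ α₂ (mapCoeff₁ α₁ α₂ • (Q * Q.transpose) + K) 0 := by
  have hdet : IsUnit Q.det := (Matrix.isUnit_iff_isUnit_det Q).1 hQ
  have hskew : (Q⁻¹ * K * Q⁻¹.transpose).transpose = -(Q⁻¹ * K * Q⁻¹.transpose) := by
    simp only [Matrix.transpose_mul, Matrix.transpose_transpose, hK, Matrix.neg_mul,
      Matrix.mul_neg, Matrix.mul_assoc]
  convert (realizes_smul_one_add_skew hα hskew).congr_mul Q using 1
  have h₁ : Q⁻¹.transpose * Q.transpose = 1 := by
    rw [← Matrix.transpose_mul, Matrix.mul_nonsing_inv Q hdet, Matrix.transpose_one]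
  have h₂ : Q * (Q⁻¹ * K * Q⁻¹.transpose) * Q.transpose = K := by
    rw [Matrix.mul_assoc, Matrix.mul_assoc, h₁, Matrix.mul_one, ← Matrix.mul_assoc,
      Matrix.mul_nonsing_inv Q hdet, Matrix.one_mul]
  rw [Matrix.mul_add, Matrix.add_mul, h₂, Matrix.mul_smul, Matrix.mul_one, Matrix.smul_mul]

open scoped MatrixOrder in
theorem realizes_of_posDef {d : ℕ} {α₁ α₂ : ℝ} (hα : α₁ + α₂ ≠ 0)
    {T : Matrix (Fin d) (Fin d) ℝ}
    (hT : (mapCoeff₁ α₁ α₂ • (T + T.transpose)).PosDef) : Realizes α₁ α₂ T 0 := by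
  rcases Nat.eq_zero_or_pos d with rfl | hd
  · rw [Subsingleton.elim T 0]
    exact realizes_zero α₁ α₂
  have hc : mapCoeff₁ α₁ α₂ ≠ 0 := by
    intro h
    have := hT.diag_pos (i := ⟨0, hd⟩)
    simp [h] at this
  set c := mapCoeff₁ α₁ α₂ with hcdef
  -- This is `(T + Tᵀ)/(2c)`, to be factored as `Q Qᵀ` with `Q = Bᵀ`; it is positive definite for
  -- either sign of `c`.
  have hH : ((2 * c ^ 2)⁻¹ • (c • (T + T.transpose))).PosDef := hT.smul (by positivity)
  obtain ⟨B, hBT⟩ := CStarAlgebra.nonneg_iff_eq_star_mul_self.1 hH.posSemidef.nonneg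
  rw [Matrix.star_eq_conjTranspose, Matrix.conjTranspose_eq_transpose_of_trivial] at hBT
  have hB : IsUnit B := by
    have h := (Matrix.isUnit_iff_isUnit_det _).1 hH.isUnit
    rw [hBT, Matrix.det_mul] at h
    exact (Matrix.isUnit_iff_isUnit_det _).2 (isUnit_of_mul_isUnit_right h)
  have hskew : ((2⁻¹ : ℝ) • (T - T.transpose)).transpose = -((2⁻¹ : ℝ) • (T - T.transpose)) := by
    ext a b
    simp
    ring
  have h := realizes_smul_mul_transpose_add_skew hα hskew
    ((Matrix.isUnit_transpose (A := B)).2 hB)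
  rw [Matrix.transpose_transpose, ← hBT, ← hcdef] at h
  convert h using 1
  ext a b
  simp only [Matrix.add_apply, Matrix.sub_apply, Matrix.smul_apply, Matrix.transpose_apply,
    smul_eq_mul]
  field_simp
  ring

theorem realizes_of_skew {d : ℕ} {α₁ α₂ : ℝ} (hα : α₁ + α₂ ≠ 0)
    {T : Matrix (Fin d) (Fin d) ℝ} (hT : T.transpose = -T) (hc : mapCoeff₁ α₁ α₂ = 0) :
    Realizes α₁ α₂ T 0 := by
  simpa [hc] using realizes_smul_one_add_skew hα hT

theorem Realizes.exists_mapMatrix {d : ℕ} {α₁ α₂ : ℝ} {T : Matrix (Fin d) (Fin d) ℝ}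
    (hT : Realizes α₁ α₂ T 0) :
    ∃ m : ℕ, T.rank + 1 ≤ m ∧ ∃ W : Matrix (Fin d) (Fin m) ℝ,
      W * mapMatrix α₁ α₂ m * W.transpose = T ∧ W.mulVec (fun _ => 1) = 0 := by
  obtain ⟨p, V, hV, hV0⟩ := hT
  -- The zero column meets the zero border of `mapMatrix` and keeps the column sum; it also provides
  -- the `+ 1` over the rank.
  refine ⟨p + 1, ?_, Matrix.of fun a => Fin.snoc (V a) 0, ?_, ?_⟩
  · have h₁ : T.rank ≤ V.rank := by
      rw [← hV, Matrix.mul_assoc]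
      exact Matrix.rank_mul_le_left _ _
    have h₂ := V.rank_le_width
    omega
  · rw [← hV]
    ext a b
    simp only [mul_mul_transpose_apply, Fin.sum_univ_castSucc, Matrix.of_apply,
      Fin.snoc_castSucc, Fin.snoc_last, zero_mul, mul_zero, Finset.sum_const_zero, add_zero]
    refine Finset.sum_congr rfl fun i _ => Finset.sum_congr rfl fun j _ => ?_
    have hi := i.isLt.ne
    have hj := j.isLt.ne
    simp [mapMatrix, mapBlock, hi, hj]
  · ext a
    have := congrFun hV0 a
    simpa [Matrix.mulVec, dotProduct, Fin.sum_univ_castSucc] using this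

theorem theorem3 (α₁ α₂ : ℝ) (hα : α₁ + α₂ ≠ 0) (n : ℕ)
    (T : Matrix (Fin (2 * n)) (Fin (2 * n)) ℝ)
    (hT : (IsStarNormal T ∧
            ((2 * α₂ - (α₁ + α₂) ^ 2) • (T + T.transpose)).PosDef ∧
            InterlacingProperty) ∨
          (T.transpose = -T ∧ 2 * α₂ - (α₁ + α₂) ^ 2 = 0)) :
    ∃ m : ℕ, T.rank + 1 ≤ m ∧
      ∃ W : Matrix (Fin (2 * n)) (Fin m) ℝ,
        W * mapMatrix α₁ α₂ m * W.transpose = T ∧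
        W.mulVec (fun _ => 1) = 0 := by
  apply Realizes.exists_mapMatrix
  rcases hT with ⟨-, hpd, -⟩ | ⟨hskew, hc⟩
  · exact realizes_of_posDef hα hpd
  · exact realizes_of_skew hα hskew hc
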